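/- Let $K$ be a field, let $n$ be a natural number, and let $\mathcal M$ be a $K$-subspace of the matrix algebra $\operatorname{Mat}_n(K)$. Call $\mathcal M$ a left (respectively right, pre-two-sided, two-sided) Mathieu subspace of $\operatorname{Mat}_n(K)$ if for all $a, b, c \in \operatorname{Mat}_n(K)$ such that $a^m \in \mathcal M$ for every $m \ge 1$, one has, for all sufficiently large $m$ (depending on $a,b,c$), $ba^m \in \mathcal M$ (respectively $a^mc \in \mathcal M$; both $ba^m \in \mathcal M$ and $a^mc \in \mathcal M$; $ba^mc \in \mathcal M$). Let $\mathfrak r(\mathcal M) = \{a \in \operatorname{Mat}_n(K) \mid a^m \in \mathcal M \text{ for all sufficiently large } m\}$ be the radical of $\mathcal M$. Suppose that $\mathcal M \neq \operatorname{Mat}_n(K)$, that $\mathcal M$ is a Mathieu subspace of $\operatorname{Mat}_n(K)$ of at least one of these four types, and that the codimension of $\mathcal M$ in $\operatorname{Mat}_n(K)$ is less than $\min\{n, \#K\}$, where $\#K$ is the (possibly infinite) cardinality of $K$. Then $\operatorname{tr} A = 0$ for all $A \in \mathcal M$. If moreover the characteristic of $K$ is not in $\{1,2,\ldots,n-1\}$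 (in particular if it is $0$), then every element of $\mathfrak r(\mathcal M)$ is nilpotent and $\mathcal M$ is a two-sided Mathieu subspace of $\operatorname{Mat}_n(K)$. -/

import Mathlib

open Filter

/-- The four types of Mathieu subspaces. -/
inductive MathieuType where
  | left
  | right
  | preTwoSided
  | twoSided

/-- An `R`-submodule `M` of an associative `R`-algebra `A` is a Mathieu subspace of type `θ` if,
for all `a b c : A` such that `a ^ m ∈ M` for every `m ≥ 1`, the condition attached to the type `θ`
holds for all sufficiently large `m` (how large may depend on `a`, `b` and `c`). -/
def IsMathieuSubspace {R A : Type*} [CommRing R] [Ring A] [Algebra R A]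
    (θ : MathieuType) (M : Submodule R A) : Prop :=
  ∀ a b c : A, (∀ m : ℕ, 1 ≤ m → a ^ m ∈ M) →
    match θ with
    | .left => ∀ᶠ m : ℕ in atTop, b * a ^ m ∈ M
    | .right => ∀ᶠ m : ℕ in atTop, a ^ m * c ∈ M
    | .preTwoSided => ∀ᶠ m : ℕ in atTop, b * a ^ m ∈ M ∧ a ^ m * c ∈ M
    | .twoSided => ∀ᶠ m : ℕ in atTop, b * a ^ m * c ∈ M

/-- The radical of a subset `S`: all `a` such that `a ^ m ∈ S` for all sufficiently large `m`. -/
def mathieuRadical {A : Type*} [Ring A] (S : Set A) : Set A :=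
  {a | ∀ᶠ m : ℕ in atTop, a ^ m ∈ S}

/-! Let `W` be the orthogonal of `M` for the form `tr (f * g)`, so `dim W = codim M`. It suffices to
show `1 ∈ W`. If left multiples of idempotents of `M` stay in `M`, nondegeneracy gives `e * C = 0`
for every idempotent `e ∈ M` and `C ∈ W`; the case of right multiples follows by transposing.
Deforming a projection onto `U` to one orthogonal to `W` shows that, when `U` meets the span of the
images of `W` nontrivially, some `C ∈ W` preserves `U` without being square-zero of rank at most one
there (`KillsOrthogonalIdempotents.exists_invariant`). A dimension count makes that span all of `E`,
so every `U ≠ ⊥` qualifies. For generic `x`, well-chosen `U` containing `x` produce `C ∈ W` with `C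
x = x` that is scalar modulo `K x` (`HasInvariantElements.exists_scalar`). If `1 ∉ W`, these give
many rank-one maps in `W + K • 1`, too many for its dimension (`HasInvariantElements.one_mem`). For
the radical: a non-nilpotent element yields a nonzero idempotent of `M`; trace zero and the
characteristic force it to be `1`, which a proper `M` cannot contain. -/

section TraceForm

/-! ### Trace form and deformation of idempotents -/

variable {K E : Type*} [Field K] [AddCommGroup E] [Module K E]

/-- The bilinear form `(f, g) ↦ tr (f * g)` on endomorphisms. -/
noncomputable def traceMulForm (K E : Type*) [Field K] [AddCommGroup E] [Module K E] :
    LinearMap.BilinForm K (Module.End K E) :=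
  (LinearMap.mul K (Module.End K E)).compr₂ (LinearMap.trace K E)

theorem traceMulForm_apply (f g : Module.End K E) :
    traceMulForm K E f g = LinearMap.trace K E (f * g) := rfl

theorem traceMulForm_isSymm : (traceMulForm K E).IsSymm :=
  ⟨fun f g => by simpa [traceMulForm_apply] using LinearMap.trace_mul_comm K f g⟩

theorem traceMulForm_nondegenerate [FiniteDimensional K E] : (traceMulForm K E).Nondegenerate := by
  have hrefl : LinearMap.IsRefl (traceMulForm K E) := traceMulForm_isSymm.isRefl
  rw [LinearMap.BilinForm.Nondegenerate, hrefl.nondegenerate_iff_separatingLeft]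
  intro f hf
  ext x
  refine (Module.forall_dual_apply_eq_zero_iff K (f x)).1 fun φ => ?_
  have h := hf (φ.smulRight x)
  have h2 : f * φ.smulRight x = φ.smulRight (f x) := by
    ext y; simp
  rwa [traceMulForm_apply, h2, LinearMap.trace_smulRight] at h

/-- If the trace of `C * e` vanishes for all `C ∈ W` leaving the range of the idempotent `e`
invariant, then `e` can be moved, with its range unchanged, to an idempotent which is
trace-orthogonal to `W`. -/
theorem exists_idempotent_orthogonal [FiniteDimensional K E] (W : Submodule K (Module.End K E)) {e : Module.End K E}
    (he : IsIdempotentElem e)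
    (h : ∀ C ∈ W, e * C * e = C * e → LinearMap.trace K E (C * e) = 0) :
    ∃ e' : Module.End K E, IsIdempotentElem e' ∧ e * e' = e' ∧ e' * e = e ∧
      ∀ C ∈ W, LinearMap.trace K E (C * e') = 0 := by
  let ρ : W →ₗ[K] Module.End K E :=
    (LinearMap.mulLeft K (1 - e) ∘ₗ LinearMap.mulRight K e) ∘ₗ W.subtype
  let f : Module.Dual K W := (LinearMap.trace K E ∘ₗ LinearMap.mulRight K e) ∘ₗ W.subtype
  have hf : f ∈ (LinearMap.ker ρ).dualAnnihilator := by
    rw [Submodule.mem_dualAnnihilator]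
    intro C hC
    have hC' : (1 - e) * (C.1 * e) = 0 := hC
    refine h C.1 C.2 ?_
    rw [sub_mul, one_mul, sub_eq_zero] at hC'
    rw [mul_assoc, ← hC']
  rw [← LinearMap.range_dualMap_eq_dualAnnihilator_ker] at hf
  obtain ⟨g, hg⟩ := hf
  obtain ⟨G, hG⟩ := ((traceMulForm K E).toDual traceMulForm_nondegenerate).surjective g
  have hee : e * e = e := he
  -- The functional `C ↦ tr (C * e)` kills the kernel of `C ↦ (1 - e) * C * e`, so it is `tr (G * (1
  -- - e) * C * e)` for some `G`; the correction term cancels it by cyclicity.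
  refine ⟨e - e * G * (1 - e), ?_, ?_, ?_, ?_⟩
  · have h1 : (1 - e) * e = 0 := by rw [sub_mul, one_mul, hee, sub_self]
    have h2 : e * (1 - e) = 0 := by rw [mul_sub, mul_one, hee, sub_self]
    change (e - e * G * (1 - e)) * (e - e * G * (1 - e)) = _
    have h3 : (1 - e) * (e * G * (1 - e)) = 0 := by
      rw [← mul_assoc, ← mul_assoc, h1, zero_mul, zero_mul]
    have h4 : e * (e * G * (1 - e)) = e * G * (1 - e) := by
      rw [← mul_assoc, ← mul_assoc, hee]
    have h5 : e * G * (1 - e) * e = 0 := by rw [mul_assoc, h1, mul_zero]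
    have h6 : e * G * (1 - e) * (e * G * (1 - e)) = 0 := by rw [mul_assoc (e * G), h3, mul_zero]
    rw [sub_mul, mul_sub e, mul_sub (e * G * (1 - e)) e, h4, h5, h6, hee, sub_zero, sub_zero]
  · rw [mul_sub, ← mul_assoc, ← mul_assoc, hee]
  · rw [sub_mul, mul_assoc (e * G), sub_mul, one_mul, hee]; simp
  · intro C hC
    have h1 : f ⟨C, hC⟩ = g (ρ ⟨C, hC⟩) := by rw [← hg]; rfl
    have h2 : LinearMap.trace K E (C * e) = LinearMap.trace K E (G * ((1 - e) * (C * e))) := by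
      have : g (ρ ⟨C, hC⟩) = LinearMap.trace K E (G * ((1 - e) * (C * e))) := by
        rw [← hG]; rfl
      rw [← this, ← h1]; rfl
    rw [mul_sub, map_sub, h2, sub_eq_zero, ← mul_assoc, LinearMap.trace_mul_comm, mul_assoc C,
      mul_assoc e]

end TraceForm

/-! ### Elements of `W` preserving a subspace -/

section Invariant

variable {K E : Type*} [Field K] [AddCommGroup E] [Module K E]

/-- Every idempotent which is trace-orthogonal to `W` annihilates `W` from the left. -/
def KillsOrthogonalIdempotents (W : Submodule K (Module.End K E)) : Prop :=
  ∀ e : Module.End K E, IsIdempotentElem e → (∀ C ∈ W, LinearMap.trace K E (C * e) = 0) →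
    ∀ C ∈ W, e * C = 0

variable [FiniteDimensional K E] {W : Submodule K (Module.End K E)}

/-- Otherwise each `C ∈ W` preserving `U` is nilpotent on `U`, hence traceless there. Then some
projection onto `U` is orthogonal to `W`; it kills every image of `W`, yet fixes `v`. -/
theorem KillsOrthogonalIdempotents.exists_invariant (hW : KillsOrthogonalIdempotents W)
    {U : Submodule K E} {v : E} (hv : v ∈ Submodule.span K {v | ∃ C ∈ W, ∃ z, C z = v})
    (hvU : v ∈ U) (hv0 : v ≠ 0) :
    ∃ C ∈ W, (∀ u ∈ U, C u ∈ U) ∧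
      ∀ x ∈ U, C x = 0 → ¬ ∀ u ∈ U, C u ∈ Submodule.span K {x} := by
  by_contra! hcon
  obtain ⟨V, hUV⟩ := U.exists_isCompl
  set e : Module.End K E := U.projection V hUV with he_def
  have he : IsIdempotentElem e := Submodule.isIdempotentElem_projection hUV
  have heU : ∀ u ∈ U, e u = u := fun u hu => Submodule.projection_apply_of_mem_left hUV hu
  have hem : ∀ v, e v ∈ U := fun v => Submodule.projection_apply_mem hUV v
  obtain ⟨e', he', h1, h2, h3⟩ := exists_idempotent_orthogonal W he (by
    intro C hC hCe
    obtain ⟨x, hx, hCx, hCU⟩ := hcon C hC (fun u hu => by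
      have := LinearMap.congr_fun hCe u
      simp only [Module.End.mul_apply, heU u hu] at this
      rw [← this]; exact hem _)
    have hnil : IsNilpotent (C * e) := by
      refine ⟨2, ?_⟩
      ext v
      obtain ⟨c, hc⟩ := Submodule.mem_span_singleton.1 (hCU (e v) (hem v))
      simp [pow_two, ← hc, heU x hx, hCx]
    exact (LinearMap.isNilpotent_trace_of_isNilpotent hnil).eq_zero)
  have h4 : Submodule.span K {v | ∃ C ∈ W, ∃ z, C z = v} ≤ LinearMap.ker e' := by
    rw [Submodule.span_le]
    rintro _ ⟨C, hC, z, rfl⟩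
    exact LinearMap.congr_fun (hW e' he' h3 C hC) z
  have h5 := LinearMap.congr_fun h2 v
  simp only [Module.End.mul_apply, heU _ hvU] at h5
  exact hv0 (h5.symm.trans (h4 hv))

end Invariant

/-! ### The images of `W` span the whole space -/

section ProperImage

variable {K E : Type*} [Field K] [AddCommGroup E] [Module K E] [FiniteDimensional K E]
  {W : Submodule K (Module.End K E)}

/-- The projections onto `U` are the maps `p + ι Q` with `Q : V → U`. One orthogonal to `W` must
kill `V`, forcing `Q = 0`; so `Hom (V, U)` embeds in the dual of `W`. Counting dimensions makes this
bijective, and `C` pairs to zero with every `ι Q`. -/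
theorem KillsOrthogonalIdempotents.eq_zero_of_isCompl (hW : KillsOrthogonalIdempotents W)
    (hk : Module.finrank K W < Module.finrank K E) {U V : Submodule K E}
    (hV : V = Submodule.span K {v | ∃ C ∈ W, ∃ z, C z = v}) (hV0 : V ≠ ⊥) (hV1 : V ≠ ⊤)
    (hUV : IsCompl U V) {C : Module.End K E} (hC : C ∈ W) (hCU : ∀ u ∈ U, C u = 0) : C = 0 := by
  have hCV : ∀ D ∈ W, ∀ z, D z ∈ V := fun D hD z => by
    rw [hV]; exact Submodule.subset_span ⟨D, hD, z, rfl⟩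
  have hkill : ∀ e : Module.End K E, (∀ D ∈ W, e * D = 0) → ∀ v ∈ V, e v = 0 := by
    intro e he v hv
    have : V ≤ LinearMap.ker e := by
      rw [hV, Submodule.span_le]
      rintro _ ⟨D, hD, z, rfl⟩
      exact LinearMap.congr_fun (he D hD) z
    exact this hv
  let ι : (V →ₗ[K] U) →ₗ[K] Module.End K E :=
    { toFun := fun Q => U.subtype ∘ₗ Q ∘ₗ V.projectionOnto U hUV.symm
      map_add' := fun Q Q' => by ext; simp
      map_smul' := fun c Q => by ext; simp }
  have hιV : ∀ Q (v : V), ι Q v = Q v := fun Q v => by simp [ι]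
  have hιU : ∀ Q, ∀ u ∈ U, ι Q u = 0 := fun Q u hu => by
    have := Submodule.projectionOnto_apply_right hUV.symm ⟨u, hu⟩
    simp only at this
    simp [ι, this]
  have hιm : ∀ Q v, ι Q v ∈ U := fun Q v => by simp [ι]
  let Φ : (V →ₗ[K] U) →ₗ[K] Module.Dual K W :=
    (LinearMap.lcomp K K W.subtype) ∘ₗ (traceMulForm K E).flip ∘ₗ ι
  have hΦ : ∀ Q (D : W), Φ Q D = LinearMap.trace K E (D.1 * ι Q) := fun Q D => rfl
  set p : Module.End K E := U.projection V hUV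
  have hpU : ∀ u ∈ U, p u = u := fun u hu => Submodule.projection_apply_of_mem_left hUV hu
  have hpV : ∀ v ∈ V, p v = 0 := fun v hv =>
    (Submodule.projection_apply_eq_zero_iff hUV).2 hv
  have hpm : ∀ v, p v ∈ U := fun v => Submodule.projection_apply_mem hUV v
  have hinj : Function.Injective Φ := by
    rw [injective_iff_map_eq_zero]
    intro Q hQ
    have hidem : IsIdempotentElem (p + ι Q) := by
      change (p + ι Q) * (p + ι Q) = _
      ext v
      simp [hpU _ (hpm v), hpU _ (hιm Q v), hιU _ _ (hpm v), hιU _ _ (hιm Q v)]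
    have h1 := hkill _ (hW _ hidem (fun D hD => by
      have h2 : LinearMap.trace K E (D * ι Q) = 0 := by
        rw [← hΦ Q ⟨D, hD⟩, hQ]; rfl
      have h4 : p * D = 0 := by
        ext v
        simp [hpV _ (hCV D hD v)]
      rw [mul_add, map_add, h2, add_zero, LinearMap.trace_mul_comm, h4, map_zero]))
    ext v
    have h5 := h1 v.1 v.2
    simpa [hpV _ v.2, hιV] using h5
  have hrank : Module.finrank K (V →ₗ[K] U) = Module.finrank K (Module.Dual K W) := by
    -- For positive dimensions, `dim V * dim U ≥ dim V + dim U - 1 = dim E - 1 ≥ dim W`.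
    refine le_antisymm (LinearMap.finrank_le_finrank_of_injective hinj) ?_
    rw [Subspace.dual_finrank_eq, Module.finrank_linearMap]
    have h1 := Submodule.finrank_add_eq_of_isCompl hUV
    have h2 : 0 < Module.finrank K V := Submodule.one_le_finrank_iff.2 hV0
    have h3 : Module.finrank K V < Module.finrank K E := Submodule.finrank_lt hV1
    obtain ⟨a, ha⟩ := Nat.exists_eq_succ_of_ne_zero h2.ne'
    obtain ⟨b, hb⟩ : ∃ b, Module.finrank K U = b + 1 :=
      Nat.exists_eq_succ_of_ne_zero (by omega)
    rw [ha, hb]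
    have : Module.finrank K W ≤ a + b + 1 := by omega
    nlinarith [Nat.zero_le (a * b)]
  have hsurj : Function.Surjective Φ :=
    (LinearMap.injective_iff_surjective_of_finrank_eq_finrank hrank).1 hinj
  have : (⟨C, hC⟩ : W) = 0 := by
    refine (Module.forall_dual_apply_eq_zero_iff K _).1 fun g => ?_
    obtain ⟨Q, rfl⟩ := hsurj g
    rw [hΦ]
    have : C * ι Q = 0 := by
      ext v
      simp [hCU _ (hιm Q v)]
    rw [this, map_zero]
  simpa using this

theorem KillsOrthogonalIdempotents.span_range_eq_top (hW : KillsOrthogonalIdempotents W)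
    (hW0 : W ≠ ⊥) (hk : Module.finrank K W < Module.finrank K E) :
    Submodule.span K {v | ∃ C ∈ W, ∃ z, C z = v} = ⊤ := by
  by_contra hV1
  generalize hV : Submodule.span K {v | ∃ C ∈ W, ∃ z, C z = v} = V at hV1
  have hCV : ∀ D ∈ W, ∀ z, D z ∈ V := fun D hD z => by
    rw [← hV]; exact Submodule.subset_span ⟨D, hD, z, rfl⟩
  obtain ⟨C₀, hC₀, hC₀'⟩ := Submodule.exists_mem_ne_zero_of_ne_bot hW0
  obtain ⟨z, hz⟩ : ∃ z, C₀ z ≠ 0 := by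
    by_contra! h
    exact hC₀' (LinearMap.ext h)
  set x := C₀ z with hx
  have hxV : x ∈ V := hCV _ hC₀ _
  have hV0 : V ≠ ⊥ := fun h => hz (by simpa [h] using hxV)
  obtain ⟨U, hVU⟩ := V.exists_isCompl
  have hUV := hVU.symm
  obtain ⟨C, hC, hCU, hCx⟩ := hW.exists_invariant (U := U ⊔ Submodule.span K {x})
    (hV ▸ hxV) (Submodule.mem_sup_right (Submodule.mem_span_singleton_self x)) hz
  have hxU : x ∈ U ⊔ Submodule.span K {x} :=
    Submodule.mem_sup_right (Submodule.mem_span_singleton_self x)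
  have hCs : ∀ u ∈ U ⊔ Submodule.span K {x}, C u ∈ Submodule.span K {x} := by
    intro u hu
    obtain ⟨a, ha, b, hb, hab⟩ := Submodule.mem_sup.1 (hCU u hu)
    have hbV : b ∈ V := (Submodule.span_singleton_le_iff_mem x V).2 hxV hb
    have haV : a ∈ V := by
      have : a = C u - b := by rw [← hab]; abel
      rw [this]; exact V.sub_mem (hCV C hC u) hbV
    have : a = 0 := (Submodule.disjoint_def.1 hUV.disjoint) a ha haV
    rw [← hab, this, zero_add]; exact hb
  obtain ⟨α, hα⟩ := Submodule.mem_span_singleton.1 (hCs x hxU)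
  have hα0 : α ≠ 0 := by
    rintro rfl
    rw [zero_smul] at hα
    exact hCx x hxU hα.symm hCs
  have hCC : ∀ u ∈ U, C (C u) = α • C u := by
    intro u hu
    obtain ⟨c, hc⟩ := Submodule.mem_span_singleton.1 (hCs u (Submodule.mem_sup_left hu))
    rw [← hc, map_smul, ← hα, smul_comm]
  -- On `U`, `C * C = α • C`, so `C` kills `s U`, which is again a complement of `V`.
  let s : Module.End K E := 1 - α⁻¹ • C
  have hcompl : IsCompl (U.map s) V := by
    constructor
    · rw [Submodule.disjoint_def]
      rintro _ ⟨u, hu, rfl⟩ hv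
      have : u ∈ V := by
        have h1 : u = s u + α⁻¹ • C u := by simp [s]
        rw [h1]; exact V.add_mem hv (V.smul_mem _ (hCV C hC u))
      rw [(Submodule.disjoint_def.1 hUV.disjoint) u hu this, map_zero]
    · rw [codisjoint_iff, eq_top_iff]
      intro y _
      obtain ⟨u, hu, v, hv, rfl⟩ := Submodule.mem_sup.1
        (show y ∈ U ⊔ V by rw [hUV.sup_eq_top]; trivial)
      refine Submodule.mem_sup.2 ⟨s u, ⟨u, hu, rfl⟩, α⁻¹ • C u + v,
        V.add_mem (V.smul_mem _ (hCV C hC u)) hv, ?_⟩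
      simp only [s, LinearMap.sub_apply, Module.End.one_apply, LinearMap.smul_apply]
      abel
  have hC0 := hW.eq_zero_of_isCompl hk hV.symm hV0 hV1 hcompl hC (by
    rintro _ ⟨u, hu, rfl⟩
    simp [s, hCC u hu, smul_smul, inv_mul_cancel₀ hα0])
  rw [hC0] at hα
  exact hz ((smul_eq_zero.1 hα).resolve_left hα0)

end ProperImage

/-! ### Maps that are scalar modulo a subspace -/

section ScalarModulo

variable {K E : Type*} [Field K] [AddCommGroup E] [Module K E]

theorem exists_notMem_of_card_lt_enatCard {K : Type*} {s : Finset K}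
    (h : (s.card : ℕ∞) < ENat.card K) : ∃ t, t ∉ s := by
  by_contra! hs
  have : (s : Set K) = Set.univ := Set.eq_univ_of_forall fun t => hs t
  rw [← Set.encard_univ, ← this, Set.encard_coe_eq_coe_finsetCard] at h
  exact lt_irrefl _ h

theorem exists_scalar_modulo {T : Module.End K E} {P : Submodule K E} (hP : ∀ p ∈ P, T p ∈ P)
    (h : ∀ y, ∃ c : K, T y - c • y ∈ P) : ∃ c : K, ∀ y, T y - c • y ∈ P := by
  let T' : Module.End K (E ⧸ P) := P.mapQ P T hP
  obtain ⟨c, hc⟩ := LinearMap.exists_eq_smul_id_of_forall_notLinearIndependent (f := T') (by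
    intro v hv
    obtain ⟨y, rfl⟩ := P.mkQ_surjective v
    obtain ⟨c, hc⟩ := h y
    have h1 : T' (P.mkQ y) = c • P.mkQ y := by
      rw [← map_smul, ← sub_eq_zero]
      simpa [T', ← Submodule.Quotient.mk_sub, ← Submodule.Quotient.mk_smul] using hc
    have := (LinearIndependent.pair_iff.1 hv) c (-1) (by rw [h1]; simp)
    simp at this)
  refine ⟨c, fun y => ?_⟩
  have h1 := LinearMap.congr_fun hc (P.mkQ y)
  rw [LinearMap.smul_apply, Module.End.one_apply, ← map_smul, ← sub_eq_zero] at h1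
  simpa [T', ← Submodule.Quotient.mk_sub, ← Submodule.Quotient.mk_smul] using h1

/-- For `y ∈ Q` outside `P`, take `p ∉ Q` and compare the scalars at `p`, `p + y` and `c • p + y`:
`c ≠ 0` keeps the last vector outside `Q`, and `c ≠ 1` forces the scalars to agree. -/
theorem exists_scalar_modulo_of_notMem {T : Module.End K E} {P Q : Submodule K E}
    (hP : ∀ p ∈ P, T p ∈ P) (hPQ : P ≤ Q) (hQ : Q ≠ ⊤)
    (hK : Q ≤ P ∨ ∃ c : K, c ≠ 0 ∧ c ≠ 1)
    (h : ∀ y ∉ Q, ∃ c : K, T y - c • y ∈ P) : ∃ c : K, ∀ y, T y - c • y ∈ P := by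
  refine exists_scalar_modulo hP fun y => ?_
  by_cases hyP : y ∈ P
  · exact ⟨0, by simpa using hP y hyP⟩
  by_cases hy : y ∉ Q
  · exact h y hy
  rw [not_not] at hy
  obtain ⟨c, hc0, hc1⟩ := hK.resolve_left fun hle => hyP (hle hy)
  obtain ⟨p, hp⟩ : ∃ p, p ∉ Q := by
    by_contra! hall
    exact hQ (eq_top_iff.2 fun v _ => hall v)
  obtain ⟨a, ha⟩ := h p hp
  obtain ⟨b, hb⟩ := h (p + y) fun hm => hp (by simpa using Q.sub_mem hm hy)
  obtain ⟨d, hd⟩ := h (c • p + y) fun hm => hp (by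
    have h1 : c • p ∈ Q := by simpa using Q.sub_mem hm hy
    exact (Q.smul_mem_iff hc0).1 h1)
  have h1 : T y - b • y + (a - b) • p ∈ P := by
    have := P.sub_mem hb ha
    convert this using 1
    rw [map_add]; module
  have h2 : T y - d • y + (c * (a - d)) • p ∈ P := by
    have := P.sub_mem hd (P.smul_mem c ha)
    convert this using 1
    rw [map_add, map_smul]; module
  have h3 : (d - b) • y + ((a - b) - c * (a - d)) • p ∈ P := by
    convert P.sub_mem h1 h2 using 1
    module
  have h4 : (a - b) - c * (a - d) = 0 := by
    by_contra hne
    have : ((a - b) - c * (a - d)) • p ∈ Q := by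
      simpa using Q.sub_mem (hPQ h3) (Q.smul_mem (d - b) hy)
    exact hp ((Q.smul_mem_iff hne).1 this)
  rw [h4, zero_smul, add_zero] at h3
  have h5 : d = b := by
    by_contra hne
    exact hyP ((P.smul_mem_iff (sub_ne_zero.2 hne)).1 h3)
  subst h5
  have h6 : (1 - c) * (a - d) = 0 := by linear_combination h4
  have h7 : a - d = 0 := (mul_eq_zero.1 h6).resolve_left (sub_ne_zero.2 (Ne.symm hc1))
  rw [h7, zero_smul, add_zero] at h1
  exact ⟨d, h1⟩

/-- Invariance of `Q` is automatic: for `u ∈ Q`, `T u` lies in `Q + K p` for every `p ∉ Q`, and two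
choices of `p` independent modulo `Q` leave only `Q`. -/
theorem exists_scalar_modulo_self {T : Module.End K E} {Q : Submodule K E}
    (hQ : ∀ p, Q ⊔ Submodule.span K {p} ≠ ⊤)
    (h : ∀ y ∉ Q, ∃ c : K, T y - c • y ∈ Q) : ∃ c : K, ∀ y, T y - c • y ∈ Q := by
  have key : ∀ u ∈ Q, ∀ p ∉ Q, ∃ a : K, T u - a • p ∈ Q := by
    intro u hu p hp
    obtain ⟨a, ha⟩ := h p hp
    obtain ⟨b, hb⟩ := h (p + u) fun hm => hp (by simpa using Q.sub_mem hm hu)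
    refine ⟨b - a, ?_⟩
    convert Q.add_mem (Q.sub_mem hb ha) (Q.smul_mem b hu) using 1
    rw [map_add]; module
  have hTQ : ∀ u ∈ Q, T u ∈ Q := by
    intro u hu
    obtain ⟨p, hp⟩ : ∃ p, p ∉ Q := by
      by_contra! hall
      exact hQ 0 (eq_top_iff.2 fun v _ => Submodule.mem_sup_left (hall v))
    obtain ⟨p', hp'⟩ : ∃ p', p' ∉ Q ⊔ Submodule.span K {p} := by
      by_contra! hall
      exact hQ p (eq_top_iff.2 fun v _ => hall v)
    obtain ⟨a, ha⟩ := key u hu p hp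
    obtain ⟨b, hb⟩ := key u hu p' fun hm => hp' (Submodule.mem_sup_left hm)
    have h1 : b • p' ∈ Q ⊔ Submodule.span K {p} := by
      refine Submodule.mem_sup.2 ⟨(T u - a • p) - (T u - b • p'), Q.sub_mem ha hb, a • p,
        Submodule.smul_mem _ _ (Submodule.mem_span_singleton_self p), by module⟩
    have hb0 : b = 0 := by
      by_contra hne
      exact hp' ((Submodule.smul_mem_iff _ hne).1 h1)
    simpa [hb0] using hb
  refine exists_scalar_modulo hTQ fun y => ?_
  by_cases hy : y ∈ Q
  · exact ⟨0, by simpa using hTQ y hy⟩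
  · exact h y hy

end ScalarModulo

/-! ### Affine families of maps and translated vectors -/

section Translates

variable {K E X Z : Type*} [Field K] [AddCommGroup E] [Module K E] [AddCommGroup X] [Module K X]
  [FiniteDimensional K X] [AddCommGroup Z] [Module K Z]

/-- If for all translates of the `m` vectors `u i` by elements of `Q`, some member of an affine
family of dimension less than `m` of linear maps kills these translates, then some member kills
`Q` and all `u i`. -/
theorem exists_mem_forall_apply_eq_zero (f : X →ₗ[K] E →ₗ[K] Z) (Q : Submodule K E) :
    ∀ (m : ℕ) (L : Submodule K X) (R : E →ₗ[K] Z) (u : Fin m → E), Module.finrank K L < m →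
      (∀ q : Fin m → Q, ∃ N ∈ L, ∀ i, (R + f N) (u i + q i) = 0) →
      ∃ N ∈ L, (∀ v ∈ Q, (R + f N) v = 0) ∧ ∀ i, (R + f N) (u i) = 0 := by
  intro m
  induction m with
  | zero => intro L R u h; simp at h
  | succ m ih =>
    intro L R u hL h
    -- If this fails, fix a bad translate `u 0 + v`: the members killing it form a smaller affine
    -- family, recentred at `N₀`, to which induction applies with the other vectors.
    by_cases hall : ∀ v ∈ Q, ∀ N ∈ L, (R + f N) (u 0 + v) = 0
    · obtain ⟨N, hN, hN'⟩ := h 0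
      refine ⟨N, hN, fun v hv => ?_, fun i => by simpa using hN' i⟩
      have h0 := hall 0 Q.zero_mem N hN
      have h1 := hall v hv N hN
      rw [add_zero] at h0
      rwa [map_add, h0, zero_add] at h1
    · push Not at hall
      obtain ⟨v, hv, N₁, hN₁, hne⟩ := hall
      obtain ⟨N₀, hN₀, hN₀'⟩ := h fun _ => ⟨v, hv⟩
      have hz : (R + f N₀) (u 0 + v) = 0 := hN₀' 0
      set L' : Submodule K X := L ⊓ LinearMap.ker (LinearMap.applyₗ (u 0 + v) ∘ₗ f) with hL'
      have hmem : ∀ N, N ∈ L' ↔ N ∈ L ∧ f N (u 0 + v) = 0 := fun N => by simp [hL']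
      have hlt : L' < L := by
        refine lt_of_le_of_ne inf_le_left fun heq => hne ?_
        have h1 : N₁ - N₀ ∈ L' := by rw [heq]; exact L.sub_mem hN₁ hN₀
        have h2 := ((hmem _).1 h1).2
        rw [map_sub, LinearMap.sub_apply, sub_eq_zero] at h2
        rw [LinearMap.add_apply] at hz ⊢
        rwa [h2]
      obtain ⟨N, hN, hNQ, hNu⟩ := ih L' (R + f N₀) (fun i => u i.succ)
        (by have := Submodule.finrank_lt_finrank_of_lt hlt; omega) (by
          intro q
          obtain ⟨N, hN, hN'⟩ := h (Fin.cons ⟨v, hv⟩ q)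
          refine ⟨N - N₀, (hmem _).2 ⟨L.sub_mem hN hN₀, ?_⟩, fun i => ?_⟩
          · have h1 : (R + f N) (u 0 + v) = 0 := hN' 0
            rw [LinearMap.add_apply] at hz h1
            rw [map_sub, LinearMap.sub_apply, sub_eq_zero]
            exact add_left_cancel (h1.trans hz.symm)
          · have h1 := hN' i.succ
            simp only [Fin.cons_succ] at h1
            rw [add_assoc, ← map_add, add_sub_cancel]
            exact h1)
      rw [add_assoc, ← map_add] at hNQ hNu
      refine ⟨N₀ + N, L.add_mem hN₀ ((hmem N).1 hN).1, hNQ, fun i => ?_⟩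
      refine Fin.cases ?_ (fun j => hNu j) i
      have h1 : (R + f (N₀ + N)) (u 0 + v) = 0 := by
        have h2 : R + f (N₀ + N) = (R + f N₀) + f N := by rw [map_add, add_assoc]
        rw [h2, LinearMap.add_apply, hz, zero_add]
        exact ((hmem N).1 hN).2
      rwa [map_add, hNQ v hv, add_zero] at h1

end Translates

/-! ### Generic vectors -/

section Generic

variable {K E : Type*} [Field K] [AddCommGroup E] [Module K E]

/-- A left inverse `g` of the injective map given by `b` turns the family into `t • 1 - T`, so only
the eigenvalues of `T` can be bad. -/
theorem exists_linearIndependent_add_smul {ι : Type*} [Fintype ι] (a : ι → E) {b : ι → E}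
    (hb : LinearIndependent K b) (hK : (Fintype.card ι : ℕ∞) < ENat.card K) :
    ∃ t : K, LinearIndependent K fun i => a i + t • b i := by
  classical
  obtain ⟨g, hg⟩ := (Fintype.linearCombination K b).exists_leftInverse_of_injective
    (LinearMap.ker_eq_bot.2 (linearIndependent_iff_injective_fintypeLinearCombination.1 hb))
  let T : Module.End K (ι → K) := -(g ∘ₗ Fintype.linearCombination K a)
  obtain ⟨t, ht⟩ := exists_notMem_of_card_lt_enatCard (s := T.charpoly.roots.toFinset) <| by
    refine lt_of_le_of_lt ?_ hK
    have h1 := T.charpoly.roots.toFinset_card_le.trans (Polynomial.card_roots' _)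
    rw [LinearMap.charpoly_natDegree, Module.finrank_fintype_fun_eq_card] at h1
    exact_mod_cast h1
  have hdet : LinearMap.det (t • (1 : Module.End K (ι → K)) - T) ≠ 0 := by
    intro h0
    apply ht
    rw [Multiset.mem_toFinset, Polynomial.mem_roots T.charpoly_monic.ne_zero,
      Polynomial.IsRoot, LinearMap.eval_charpoly, ← h0]
    congr 1
  have hinj : Function.Injective (t • (1 : Module.End K (ι → K)) - T) := by
    rw [← LinearMap.ker_eq_bot]
    by_contra hker
    exact hdet (LinearMap.det_eq_zero_iff_ker_ne_bot.2 hker)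
  refine ⟨t, linearIndependent_iff_injective_fintypeLinearCombination.2 ?_⟩
  have hcomp : g ∘ₗ Fintype.linearCombination K (fun i => a i + t • b i) =
      t • (1 : Module.End K (ι → K)) - T := by
    have : Fintype.linearCombination K (fun i => a i + t • b i) =
        Fintype.linearCombination K a + t • Fintype.linearCombination K b := by
      ext i
      simp [Fintype.linearCombination_apply, Pi.single_apply, Finset.sum_add_distrib]
    rw [this, LinearMap.comp_add, LinearMap.comp_smul, hg]
    simp only [T, sub_neg_eq_add]
    rw [add_comm]; rfl
  rw [← hcomp] at hinj
  exact Function.Injective.of_comp (f := g) (by simpa using hinj)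

/-- The space of values at `x` of the endomorphisms in `W`. -/
def evalSpan (W : Submodule K (Module.End K E)) (x : E) : Submodule K E :=
  W.map (LinearMap.applyₗ x)

theorem mem_evalSpan {W : Submodule K (Module.End K E)} {x v : E} :
    v ∈ evalSpan W x ↔ ∃ C ∈ W, C x = v := by
  simp [evalSpan]

/-- The vectors at which `W` takes a space of values of maximal dimension. -/
def IsGeneric (W : Submodule K (Module.End K E)) (x : E) : Prop :=
  ∀ y, Module.finrank K (evalSpan W y) ≤ Module.finrank K (evalSpan W x)

variable [FiniteDimensional K E] {W : Submodule K (Module.End K E)}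

theorem card_le_finrank_evalSpan {ι : Type*} [Fintype ι] {C : ι → Module.End K E}
    (hC : ∀ i, C i ∈ W) {x : E} (h : LinearIndependent K fun i => C i x) :
    Fintype.card ι ≤ Module.finrank K (evalSpan W x) := by
  rw [← finrank_span_eq_card h]
  refine Submodule.finrank_mono (Submodule.span_le.2 ?_)
  rintro _ ⟨i, rfl⟩
  exact mem_evalSpan.2 ⟨C i, hC i, rfl⟩

theorem exists_linearIndependent_apply (W : Submodule K (Module.End K E)) (x : E) :
    ∃ C : Fin (Module.finrank K (evalSpan W x)) → Module.End K E,
      (∀ i, C i ∈ W) ∧ LinearIndependent K (fun i => C i x) ∧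
        Submodule.span K (Set.range fun i => C i x) = evalSpan W x := by
  let b := Module.finBasis K (evalSpan W x)
  choose C hC hCx using fun i => mem_evalSpan.1 (b i).2
  have h : (fun i => C i x) = (evalSpan W x).subtype ∘ b := funext hCx
  refine ⟨C, hC, ?_, ?_⟩
  · rw [h]
    exact b.linearIndependent.map' _ (Submodule.ker_subtype _)
  · rw [h, Set.range_comp, Submodule.span_image, b.span_eq, Submodule.map_top,
      Submodule.range_subtype]

theorem finrank_evalSpan_add (W : Submodule K (Module.End K E)) (x : E) :
    Module.finrank K (evalSpan W x) +
      Module.finrank K ↥(W ⊓ LinearMap.ker (LinearMap.applyₗ (R := K) (M₂ := E) x)) =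
        Module.finrank K W := by
  have h := LinearMap.finrank_range_add_finrank_ker
    ((LinearMap.applyₗ (R := K) (M₂ := E) x).domRestrict W)
  rw [LinearMap.range_domRestrict, LinearMap.ker_domRestrict] at h
  rw [← h, evalSpan, add_right_inj]
  rw [← Submodule.map_comap_subtype, Submodule.finrank_map_subtype_eq]

theorem exists_isGeneric (W : Submodule K (Module.End K E)) : ∃ x, IsGeneric W x := by
  obtain ⟨x, -, hx⟩ := (measure fun x : E =>
    Module.finrank K E - Module.finrank K (evalSpan W x)).wf.has_min Set.univ ⟨0, trivial⟩
  refine ⟨x, fun y => ?_⟩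
  have h := hx y trivial
  have h1 := Submodule.finrank_le (evalSpan W y)
  change ¬ (Module.finrank K E - Module.finrank K (evalSpan W y) <
    Module.finrank K E - Module.finrank K (evalSpan W x)) at h
  omega

theorem IsGeneric.exists_add_smul {x : E} (hx : IsGeneric W x)
    (hK : (Module.finrank K W : ℕ∞) < ENat.card K) (y : E) : ∃ t : K, IsGeneric W (y + t • x) := by
  obtain ⟨C, hC, hli, -⟩ := exists_linearIndependent_apply W x
  obtain ⟨t, ht⟩ := exists_linearIndependent_add_smul (fun i => C i y) hli (by
    refine lt_of_le_of_lt ?_ hK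
    rw [Fintype.card_fin]
    exact_mod_cast Submodule.finrank_map_le _ _)
  refine ⟨t, fun z => (hx z).trans ?_⟩
  simpa using card_le_finrank_evalSpan (x := y + t • x) hC (by simpa using ht)

/-- The elements of `W` killing a generic vector take their values in the space of values of `W`
at this vector. -/
theorem IsGeneric.apply_mem_evalSpan {x : E} (hx : IsGeneric W x)
    (hK : (Module.finrank K W : ℕ∞) < ENat.card K) {N : Module.End K E} (hN : N ∈ W)
    (hNx : N x = 0) (y : E) : N y ∈ evalSpan W x := by
  by_contra hy
  obtain ⟨C, hC, hli, hspan⟩ := exists_linearIndependent_apply W x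
  have hN0 : N ≠ 0 := by
    rintro rfl
    exact hy (by simp)
  have hlt : Module.finrank K (evalSpan W x) + 1 ≤ Module.finrank K W := by
    rw [← finrank_evalSpan_add W x, add_le_add_iff_left]
    refine Submodule.one_le_finrank_iff.2 fun h => hN0 ?_
    rw [← Submodule.mem_bot K, ← h]
    exact ⟨hN, by simpa using hNx⟩
  have hli' : LinearIndependent K (Fin.cons (N y) fun i => C i x : Fin (_ + 1) → E) :=
    linearIndependent_finCons.2 ⟨hli, by rwa [hspan]⟩
  -- Since `N x = 0`, the map `t • N` takes the value `t • N y` at `y + t • x`. This gives one more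
  -- independent value than genericity of `x` allows.
  obtain ⟨t, ht⟩ := exists_linearIndependent_add_smul
    (Fin.cons 0 fun i => C i y : Fin (_ + 1) → E) hli' (by
      refine lt_of_le_of_lt ?_ hK
      rw [Fintype.card_fin]
      exact_mod_cast hlt)
  have ht0 : t ≠ 0 := by
    rintro rfl
    have := ht.ne_zero 0
    simp at this
  have h1 := card_le_finrank_evalSpan (W := W) (x := y + t • x)
    (C := (Fin.cons (t • N) C : Fin (_ + 1) → _))
    (fun i => Fin.cases (by simpa using W.smul_mem t hN) (fun j => by simpa using hC j) i) (by
      convert ht using 1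
      funext i
      refine Fin.cases ?_ (fun j => ?_) i
      · simp [hNx]
      · simp)
  have h2 := hx (y + t • x)
  rw [Fintype.card_fin] at h1
  omega

end Generic

/-! ### Elements of `W` that are scalar modulo a generic line -/

section ScalarPlusRankOne

variable {K E : Type*} [Field K] [AddCommGroup E] [Module K E]

/-- Every nonzero subspace `U` is invariant under some `C ∈ W` whose restriction to `U` is not a
square-zero map of rank at most one. -/
def HasInvariantElements (W : Submodule K (Module.End K E)) : Prop :=
  ∀ U : Submodule K E, U ≠ ⊥ → ∃ C ∈ W, (∀ u ∈ U, C u ∈ U) ∧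
    ∀ x ∈ U, C x = 0 → ¬ ∀ u ∈ U, C u ∈ Submodule.span K {x}

variable {W : Submodule K (Module.End K E)}

theorem HasInvariantElements.exists_apply_eq_self (hW : HasInvariantElements W) {x : E}
    (hx : x ≠ 0) : ∃ C ∈ W, C x = x := by
  obtain ⟨C, hC, hCU, hCx⟩ := hW (Submodule.span K {x}) (by simpa using hx)
  have hxU := Submodule.mem_span_singleton_self (R := K) x
  obtain ⟨a, ha⟩ := Submodule.mem_span_singleton.1 (hCU x hxU)
  have ha0 : a ≠ 0 := by
    rintro rfl
    rw [zero_smul] at ha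
    exact hCx x hxU ha.symm hCU
  exact ⟨a⁻¹ • C, W.smul_mem _ hC, by
    rw [LinearMap.smul_apply, ← ha, smul_smul, inv_mul_cancel₀ ha0, one_smul]⟩

/-- The condition on `U` makes `x` an eigenvector of `C`. Were the eigenvalue zero, `hgen` would put
`C U` inside `K x`, which is excluded. -/
theorem HasInvariantElements.exists_apply_eq_self_and_invariant (hW : HasInvariantElements W)
    {x : E} (hx : x ≠ 0) (hgen : ∀ N ∈ W, N x = 0 → ∀ y, N y ∈ evalSpan W x)
    {U : Submodule K E} (hxU : x ∈ U) (hU : U ⊓ evalSpan W x ≤ Submodule.span K {x}) :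
    ∃ C ∈ W, C x = x ∧ ∀ u ∈ U, C u ∈ U := by
  obtain ⟨C, hC, hCU, hCx⟩ := hW U (fun h => hx (by simpa [h] using hxU))
  obtain ⟨a, ha⟩ := Submodule.mem_span_singleton.1
    (hU ⟨hCU x hxU, mem_evalSpan.2 ⟨C, hC, rfl⟩⟩)
  have ha0 : a ≠ 0 := by
    rintro rfl
    rw [zero_smul] at ha
    exact hCx x hxU ha.symm fun u hu => hU ⟨hCU u hu, hgen C hC ha.symm u⟩
  exact ⟨a⁻¹ • C, W.smul_mem _ hC, by
    rw [LinearMap.smul_apply, ← ha, smul_smul, inv_mul_cancel₀ ha0, one_smul],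
    fun u hu => U.smul_mem _ (hCU u hu)⟩

theorem span_pair_inf_le {x y : E} {Q : Submodule K E} (hxQ : x ∈ Q) (hy : y ∉ Q) :
    Submodule.span K {x, y} ⊓ Q ≤ Submodule.span K {x} := by
  rintro v ⟨hv, hvQ⟩
  obtain ⟨a, b, rfl⟩ := Submodule.mem_span_pair.1 hv
  have hb : b • y ∈ Q := by simpa using Q.sub_mem hvQ (Q.smul_mem a hxQ)
  have hb0 : b = 0 := by
    by_contra hne
    exact hy ((Q.smul_mem_iff hne).1 hb)
  rw [hb0, zero_smul, add_zero]
  exact Submodule.smul_mem _ _ (Submodule.mem_span_singleton_self x)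

variable [FiniteDimensional K E]

/-- Here `C` is determined by `C x = x`, so the same `C` preserves every plane spanned by `x` and a
vector outside `evalSpan W x`. -/
theorem HasInvariantElements.exists_scalar_of_injective (hW : HasInvariantElements W)
    (hk : Module.finrank K W < Module.finrank K E)
    (hK : (Module.finrank K W : ℕ∞) < ENat.card K) {x : E} (hx : x ≠ 0)
    (hinj : ∀ N ∈ W, N x = 0 → N = 0) :
    ∃ C ∈ W, C x = x ∧ ∃ c : K, ∀ y, C y - c • y ∈ Submodule.span K {x} := by
  obtain ⟨C, hC, hCx⟩ := hW.exists_apply_eq_self hx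
  have hxQ : x ∈ evalSpan W x := mem_evalSpan.2 ⟨C, hC, hCx⟩
  have hle : Submodule.span K {x} ≤ evalSpan W x :=
    (Submodule.span_singleton_le_iff_mem _ _).2 hxQ
  have hr : Module.finrank K (evalSpan W x) ≤ Module.finrank K W :=
    Submodule.finrank_map_le _ _
  refine ⟨C, hC, hCx, exists_scalar_modulo_of_notMem (Q := evalSpan W x) ?_ hle ?_ ?_ ?_⟩
  · intro p hp
    obtain ⟨a, rfl⟩ := Submodule.mem_span_singleton.1 hp
    rw [map_smul, hCx]; exact hp
  · intro h
    rw [h, finrank_top] at hr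
    omega
  -- If `dim W ≤ 1`, then `evalSpan W x` is the line `K x` and nothing is left to extend; otherwise
  -- `K` has more than two elements.
  · by_cases h1 : Module.finrank K W ≤ 1
    · left
      refine (Submodule.eq_of_le_of_finrank_le hle ?_).ge
      rw [finrank_span_singleton hx]
      omega
    · right
      classical
      obtain ⟨c, hc⟩ := exists_notMem_of_card_lt_enatCard (s := ({0, 1} : Finset K)) <| by
        refine lt_of_le_of_lt ?_ hK
        exact_mod_cast Finset.card_le_two.trans (by omega)
      simp only [Finset.mem_insert, Finset.mem_singleton, not_or] at hc
      exact ⟨c, hc⟩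
  · intro y hy
    obtain ⟨D, hD, hDx, hDU⟩ := hW.exists_apply_eq_self_and_invariant hx
      (fun N hN hNx y => by simp [hinj N hN hNx])
      (Submodule.subset_span (Set.mem_insert x {y})) (span_pair_inf_le hxQ hy)
    have hDC : D - C = 0 := hinj _ (W.sub_mem hD hC) (by simp [hDx, hCx])
    rw [sub_eq_zero] at hDC
    obtain ⟨a, b, hab⟩ := Submodule.mem_span_pair.1
      (hDU y (Submodule.subset_span (Set.mem_insert_of_mem x rfl)))
    exact ⟨b, Submodule.mem_span_singleton.2 ⟨a, by rw [← hDC, ← hab]; abel⟩⟩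

/-- Now `evalSpan W x` has codimension at least two, so planes make `C` scalar modulo it.
Complements of `evalSpan W x`, enlarged by `x`, then allow a correction of `C` by some `N ∈ W`
killing `x`; such `N` form a space of dimension less than that codimension, as the translates lemma
requires. -/
theorem HasInvariantElements.exists_scalar_of_not_injective (hW : HasInvariantElements W)
    (hk : Module.finrank K W < Module.finrank K E) {x : E} (hx : x ≠ 0)
    (hgen : ∀ N ∈ W, N x = 0 → ∀ y, N y ∈ evalSpan W x)
    (hinj : ∃ N ∈ W, N x = 0 ∧ N ≠ 0) :
    ∃ C ∈ W, C x = x ∧ ∃ c : K, ∀ y, C y - c • y ∈ Submodule.span K {x} := by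
  obtain ⟨C, hC, hCx⟩ := hW.exists_apply_eq_self hx
  have hxQ : x ∈ evalSpan W x := mem_evalSpan.2 ⟨C, hC, hCx⟩
  set L : Submodule K (Module.End K E) :=
    W ⊓ LinearMap.ker (LinearMap.applyₗ (R := K) (M₂ := E) x) with hL
  have hmem : ∀ N, N ∈ L ↔ N ∈ W ∧ N x = 0 := fun N => by simp [hL]
  have hr := finrank_evalSpan_add W x
  rw [← hL] at hr
  have hL1 : 1 ≤ Module.finrank K L := by
    obtain ⟨N, hN, hNx, hN0⟩ := hinj
    refine Submodule.one_le_finrank_iff.2 fun h => hN0 ?_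
    rw [← Submodule.mem_bot K, ← h]
    exact (hmem N).2 ⟨hN, hNx⟩
  obtain ⟨c, hc⟩ := exists_scalar_modulo_self (T := C) (Q := evalSpan W x) (fun p h => by
      have h1 := Submodule.finrank_add_le_finrank_add_finrank (evalSpan W x)
        (Submodule.span K {p})
      have h2 : Module.finrank K (Submodule.span K {p}) ≤ 1 :=
        (finrank_span_le_card ({p} : Set E)).trans (by simp)
      rw [h, finrank_top] at h1
      omega) (by
    intro y hy
    obtain ⟨D, hD, hDx, hDU⟩ := hW.exists_apply_eq_self_and_invariant hx hgen
      (Submodule.subset_span (Set.mem_insert x {y})) (span_pair_inf_le hxQ hy)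
    obtain ⟨a, b, hab⟩ := Submodule.mem_span_pair.1
      (hDU y (Submodule.subset_span (Set.mem_insert_of_mem x rfl)))
    have h1 := hgen (D - C) (W.sub_mem hD hC) (by simp [hDx, hCx]) y
    refine ⟨b, ?_⟩
    convert Submodule.sub_mem _ (Submodule.smul_mem _ a hxQ) h1 using 1
    rw [LinearMap.sub_apply, ← hab]; abel)
  obtain ⟨U', hQU'⟩ := (evalSpan W x).exists_isCompl
  let u := Module.finBasis K U'
  let f : Module.End K E →ₗ[K] E →ₗ[K] (E ⧸ Submodule.span K {x}) :=
    { toFun := fun N => (Submodule.span K {x}).mkQ ∘ₗ N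
      map_add' := fun N N' => by ext; simp
      map_smul' := fun a N => by ext; simp }
  have hf : ∀ N v, (f (C - c • 1) + f N) v = 0 ↔
      (C + N) v - c • v ∈ Submodule.span K {x} := by
    intro N v
    rw [← map_add]
    change (Submodule.span K {x}).mkQ ((C - c • 1 + N) v) = 0 ↔ _
    rw [Submodule.mkQ_apply, Submodule.Quotient.mk_eq_zero]
    have : (C - c • 1 + N) v = (C + N) v - c • v := by
      simp only [LinearMap.add_apply, LinearMap.sub_apply, LinearMap.smul_apply,
        Module.End.one_apply]
      abel
    rw [this]
  obtain ⟨N, hN, hNQ, hNu⟩ := exists_mem_forall_apply_eq_zero f (evalSpan W x)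
    (Module.finrank K U') L (f (C - c • 1)) (fun i => (u i : E)) (by
      have := Submodule.finrank_add_eq_of_isCompl hQU'
      omega) (by
    intro q
    set U : Submodule K E := Submodule.span K {x} ⊔
      Submodule.span K (Set.range fun i => (u i : E) + q i) with hU
    have hxU : x ∈ U := Submodule.mem_sup_left (Submodule.mem_span_singleton_self x)
    have hUQ : U ⊓ evalSpan W x ≤ Submodule.span K {x} := by
      rintro v ⟨hv, hvQ⟩
      obtain ⟨a, ha, b, hb, rfl⟩ := Submodule.mem_sup.1 hv
      have haQ : a ∈ evalSpan W x := (Submodule.span_singleton_le_iff_mem _ _).2 hxQ ha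
      have hbQ : b ∈ evalSpan W x := by simpa using Submodule.sub_mem _ hvQ haQ
      obtain ⟨g, rfl⟩ := (Submodule.mem_span_range_iff_exists_fun K).1 hb
      have h1 : ((∑ i, g i • u i : U') : E) ∈ evalSpan W x := by
        have h2 : ∑ i, g i • (q i : E) ∈ evalSpan W x :=
          Submodule.sum_mem _ fun i _ => Submodule.smul_mem _ _ (q i).2
        convert Submodule.sub_mem _ hbQ h2 using 1
        simp [smul_add, Finset.sum_add_distrib]
      have h3 := (Submodule.disjoint_def.1 hQU'.disjoint) _ h1 (Subtype.property _)
      have h4 : ∑ i, g i • u i = 0 := Subtype.ext h3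
      have h5 := Fintype.linearIndependent_iff.1 u.linearIndependent g h4
      simpa [h5] using ha
    obtain ⟨D, hD, hDx, hDU⟩ := hW.exists_apply_eq_self_and_invariant hx hgen hxU hUQ
    have hDC : D - C ∈ L := (hmem _).2 ⟨W.sub_mem hD hC, by simp [hDx, hCx]⟩
    refine ⟨D - C, hDC, fun i => (hf _ _).2 ?_⟩
    have hwU : (u i : E) + q i ∈ U :=
      Submodule.mem_sup_right (Submodule.subset_span ⟨i, rfl⟩)
    refine hUQ ⟨?_, ?_⟩
    · rw [add_sub_cancel]
      exact U.sub_mem (hDU _ hwU) (U.smul_mem c hwU)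
    · change _ ∈ evalSpan W x
      convert Submodule.add_mem _ (hc ((u i : E) + q i))
        (hgen _ ((hmem _).1 hDC).1 ((hmem _).1 hDC).2 ((u i : E) + q i)) using 1
      rw [LinearMap.add_apply]; abel)
  refine ⟨C + N, W.add_mem hC ((hmem N).1 hN).1, ?_, c, fun y => (hf N y).1 ?_⟩
  · rw [LinearMap.add_apply, hCx, ((hmem N).1 hN).2, add_zero]
  · obtain ⟨v, hv, w, hw, rfl⟩ := Submodule.mem_sup.1
      (show y ∈ evalSpan W x ⊔ U' by rw [hQU'.sup_eq_top]; trivial)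
    have hw0 : (f (C - c • 1) + f N) w = 0 := by
      have h1 : (f (C - c • 1) + f N) ∘ₗ U'.subtype = 0 := u.ext fun i => hNu i
      exact LinearMap.congr_fun h1 ⟨w, hw⟩
    rw [map_add, hNQ v hv, hw0, add_zero]

theorem HasInvariantElements.exists_scalar (hW : HasInvariantElements W)
    (hk : Module.finrank K W < Module.finrank K E)
    (hK : (Module.finrank K W : ℕ∞) < ENat.card K) {x : E} (hx : x ≠ 0) (hgen : IsGeneric W x) :
    ∃ C ∈ W, C x = x ∧ ∃ c : K, ∀ y, C y - c • y ∈ Submodule.span K {x} := by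
  by_cases hinj : ∀ N ∈ W, N x = 0 → N = 0
  · exact hW.exists_scalar_of_injective hk hK hx hinj
  · push Not at hinj
    exact hW.exists_scalar_of_not_injective hk hx
      (fun N hN hNx => hgen.apply_mem_evalSpan hK hN hNx) hinj

end ScalarPlusRankOne

/-! ### The identity lies in `W` -/

section OneMem

variable {K E : Type*} [Field K] [AddCommGroup E] [Module K E] [FiniteDimensional K E]
  {W : Submodule K (Module.End K E)}

theorem exists_basis_isGeneric (hK : (Module.finrank K W : ℕ∞) < ENat.card K) :
    ∃ b : Module.Basis (Fin (Module.finrank K E)) K E, ∀ i, IsGeneric W (b i) := by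
  obtain ⟨x₀, hx₀⟩ := exists_isGeneric W
  have hspan : ⊤ ≤ Submodule.span K {x | IsGeneric W x} := by
    intro y _
    obtain ⟨t, ht⟩ := hx₀.exists_add_smul hK y
    have h1 : y = (y + t • x₀) - t • x₀ := by abel
    rw [h1]
    exact Submodule.sub_mem _ (Submodule.subset_span ht)
      (Submodule.smul_mem _ _ (Submodule.subset_span hx₀))
  let b := Module.Basis.ofSpan hspan
  have hb : ∀ i, IsGeneric W (b i) := fun i => Module.Basis.ofSpan_subset hspan ⟨i, rfl⟩
  have : Fintype _ := FiniteDimensional.fintypeBasisIndex b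
  exact ⟨b.reindex (Fintype.equivFinOfCardEq (Module.finrank_eq_card_basis b).symm),
    fun i => by rw [Module.Basis.reindex_apply]; exact hb _⟩

theorem HasInvariantElements.exists_isGeneric_two_coords (hW : HasInvariantElements W)
    (hk : Module.finrank K W < Module.finrank K E)
    (hK : (Module.finrank K W : ℕ∞) < ENat.card K) (hE : 2 ≤ Module.finrank K E)
    (b : Module.Basis (Fin (Module.finrank K E)) K E) (hb : ∀ i, IsGeneric W (b i)) :
    ∃ x, IsGeneric W x ∧ ∃ i j, i ≠ j ∧ b.repr x i ≠ 0 ∧ b.repr x j ≠ 0 := by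
  let i : Fin (Module.finrank K E) := ⟨0, by omega⟩
  let j : Fin (Module.finrank K E) := ⟨1, by omega⟩
  have hij : i ≠ j := by simp [i, j]
  -- In dimension two there is no third basis vector, but then `dim W ≤ 1` and every nonzero vector
  -- is generic.
  by_cases h3 : Module.finrank K E = 2
  · refine ⟨b i + b j, fun y => ?_, i, j, hij, ?_, ?_⟩
    · have hle : Module.finrank K (evalSpan W y) ≤ Module.finrank K W :=
        Submodule.finrank_map_le _ _
      have hne : b i + b j ≠ 0 := fun h => by
        have := congrArg (fun v => b.repr v i) h
        simp [hij.symm] at this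
      obtain ⟨C, hC, hCx⟩ := hW.exists_apply_eq_self hne
      have : 1 ≤ Module.finrank K (evalSpan W (b i + b j)) :=
        Submodule.one_le_finrank_iff.2 fun h => hne <| by
          rw [← Submodule.mem_bot K, ← h]
          exact mem_evalSpan.2 ⟨C, hC, hCx⟩
      omega
    · simp [hij.symm]
    · simp [hij]
  · let l : Fin (Module.finrank K E) := ⟨2, by omega⟩
    have hil : l ≠ i := by simp [i, l]
    have hjl : l ≠ j := by simp [j, l]
    obtain ⟨t, ht⟩ := (hb l).exists_add_smul hK (b i + b j)
    refine ⟨_, ht, i, j, hij, ?_, ?_⟩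
    · simp [hij.symm, hil]
    · simp [hij, hjl]

/-- If `1 ∉ W`, each generic line is the range of a rank-one map in `W'`. Those from a generic basis
span `W'`, of dimension at most `dim E`; writing `1` in them makes all of `W'` diagonal. A rank-one
diagonal map cannot have a range spanned by a vector with two nonzero coordinates. -/
theorem HasInvariantElements.one_mem (hW : HasInvariantElements W)
    (hk : Module.finrank K W < Module.finrank K E)
    (hK : (Module.finrank K W : ℕ∞) < ENat.card K) (hE : 2 ≤ Module.finrank K E) :
    (1 : Module.End K E) ∈ W := by
  by_contra h1
  set W' : Submodule K (Module.End K E) := W ⊔ Submodule.span K {1} with hW'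
  have key : ∀ x, x ≠ 0 → IsGeneric W x →
      ∃ S ∈ W', S ≠ 0 ∧ ∀ y, S y ∈ Submodule.span K {x} := by
    intro x hx hxg
    obtain ⟨C, hC, hCx, c, hc⟩ := hW.exists_scalar hk hK hx hxg
    refine ⟨C - c • 1, W'.sub_mem (Submodule.mem_sup_left hC) (W'.smul_mem c
      (Submodule.mem_sup_right (Submodule.mem_span_singleton_self 1))), fun h0 => h1 ?_, hc⟩
    rw [sub_eq_zero] at h0
    have h2 : c • x = x := by
      conv_rhs => rw [← hCx, h0]
      rfl
    have h3 : (c - 1) • x = 0 := by rw [sub_smul, one_smul, h2, sub_self]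
    have h4 : c = 1 := sub_eq_zero.1 ((smul_eq_zero.1 h3).resolve_right hx)
    rw [h4, one_smul] at h0
    rwa [← h0]
  obtain ⟨b, hb⟩ := exists_basis_isGeneric (W := W) hK
  choose S hSW hS0 hS using fun i => key (b i) (b.ne_zero i) (hb i)
  obtain ⟨x, hx, i₀, j₀, hij, hi₀, hj₀⟩ := hW.exists_isGeneric_two_coords hk hK hE b hb
  have hx0 : x ≠ 0 := by rintro rfl; simp at hi₀
  obtain ⟨S', hS'W, hS'0, hS'⟩ := key x hx0 hx
  have hφ : ∀ i y, S i y = b.repr (S i y) i • b i := by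
    intro i y
    obtain ⟨a, ha⟩ := Submodule.mem_span_singleton.1 (hS i y)
    rw [← ha]; simp
  have hrepr : ∀ (g : Fin (Module.finrank K E) → K) y j,
      b.repr ((∑ i, g i • S i) y) j = g j * b.repr (S j y) j := by
    intro g y j
    rw [LinearMap.sum_apply, map_sum, Finsupp.finsetSum_apply, Finset.sum_eq_single j]
    · simp
    · intro i _ hi
      rw [LinearMap.smul_apply, hφ i y]
      simp [hi]
    · simp
  have hli : LinearIndependent K S := by
    refine Fintype.linearIndependent_iff.2 fun g hg j => ?_
    by_contra hne
    refine hS0 j (LinearMap.ext fun y => ?_)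
    have h2 := hrepr g y j
    rw [hg] at h2
    rw [LinearMap.zero_apply, map_zero, Finsupp.zero_apply] at h2
    rw [hφ j y, (mul_eq_zero.1 h2.symm).resolve_left hne]
    simp
  have hspan : Submodule.span K (Set.range S) = W' := by
    refine Submodule.eq_of_le_of_finrank_le (Submodule.span_le.2 ?_) ?_
    · rintro _ ⟨i, rfl⟩
      exact hSW i
    · rw [finrank_span_eq_card hli, Fintype.card_fin]
      have h2 := Submodule.finrank_add_le_finrank_add_finrank W
        (Submodule.span K {(1 : Module.End K E)})
      have h3 : Module.finrank K (Submodule.span K {(1 : Module.End K E)}) ≤ 1 :=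
        (finrank_span_le_card ({1} : Set (Module.End K E))).trans (by simp)
      rw [hW']
      omega
  obtain ⟨β, hβ⟩ := (Submodule.mem_span_range_iff_exists_fun K).1
    (show (1 : Module.End K E) ∈ Submodule.span K (Set.range S) by
      rw [hspan]; exact Submodule.mem_sup_right (Submodule.mem_span_singleton_self 1))
  obtain ⟨γ, hγ⟩ := (Submodule.mem_span_range_iff_exists_fun K).1
    (show S' ∈ Submodule.span K (Set.range S) by rw [hspan]; exact hS'W)
  have hoff : ∀ i j, i ≠ j → b.repr (S i (b j)) i = 0 := by
    intro i j hne
    have h2 := hrepr β (b i) i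
    have h3 := hrepr β (b j) i
    rw [hβ] at h2 h3
    have hβi : β i ≠ 0 := fun h => by simp [h] at h2
    refine (mul_eq_zero.1 (h3.symm.trans ?_)).resolve_left hβi
    simp [hne.symm]
  refine hS'0 (b.ext fun j => ?_)
  obtain ⟨d, hd⟩ := Submodule.mem_span_singleton.1 (hS' (b j))
  have hcoord : ∀ i, i ≠ j → d * b.repr x i = 0 := by
    intro i hne
    have h2 := hrepr γ (b j) i
    rw [hγ, ← hd, hoff i j hne, mul_zero] at h2
    simpa using h2
  have hd0 : d = 0 := by
    by_cases hj : i₀ = j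
    · exact (mul_eq_zero.1 (hcoord j₀ (hj ▸ hij.symm))).resolve_right hj₀
    · exact (mul_eq_zero.1 (hcoord i₀ hj)).resolve_right hi₀
  rw [← hd, hd0]; simp

theorem KillsOrthogonalIdempotents.one_mem (hW : KillsOrthogonalIdempotents W) (hW0 : W ≠ ⊥)
    (hk : Module.finrank K W < Module.finrank K E)
    (hK : (Module.finrank K W : ℕ∞) < ENat.card K) : (1 : Module.End K E) ∈ W := by
  have htop := hW.span_range_eq_top hW0 hk
  have h1 : 1 ≤ Module.finrank K W := Submodule.one_le_finrank_iff.2 hW0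
  refine HasInvariantElements.one_mem (fun U hU => ?_) hk hK (by omega)
  obtain ⟨v, hv, hv0⟩ := Submodule.exists_mem_ne_zero_of_ne_bot hU
  exact hW.exists_invariant (by rw [htop]; trivial) hv hv0

end OneMem

/-! ### Vanishing of the trace on `M` -/

section Trace

variable {K E : Type*} [Field K] [AddCommGroup E] [Module K E] [FiniteDimensional K E]

theorem trace_eq_zero_of_forall_mul_idempotent_mem {M : Submodule K (Module.End K E)}
    (hM : M ≠ ⊤) (hl : ∀ e ∈ M, IsIdempotentElem e → ∀ b, b * e ∈ M)
    (hk : Module.finrank K (Module.End K E) - Module.finrank K M < Module.finrank K E)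
    (hK : ((Module.finrank K (Module.End K E) - Module.finrank K M : ℕ) : ℕ∞) < ENat.card K) :
    ∀ A ∈ M, LinearMap.trace K E A = 0 := by
  set W := (traceMulForm K E).orthogonal M with hW
  have hrank := LinearMap.BilinForm.finrank_orthogonal (traceMulForm_nondegenerate (K := K)
    (E := E)) M
  have hWM : (traceMulForm K E).orthogonal W = M :=
    LinearMap.BilinForm.orthogonal_orthogonal traceMulForm_nondegenerate
      traceMulForm_isSymm.isRefl M
  have hmem : ∀ C ∈ W, ∀ A ∈ M, LinearMap.trace K E (A * C) = 0 := fun C hC A hA => hC A hA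
  have hkill : KillsOrthogonalIdempotents W := by
    intro e he horth C hC
    have heM : e ∈ M := by
      rw [← hWM]
      exact fun D hD => horth D hD
    refine traceMulForm_nondegenerate.2 _ fun b => ?_
    rw [traceMulForm_apply, ← mul_assoc]
    exact hmem C hC _ (hl e heM he b)
  have hW0 : W ≠ ⊥ := by
    intro h0
    rw [h0] at hWM
    exact hM (by rw [← hWM, LinearMap.BilinForm.orthogonal_bot])
  have h1 := hkill.one_mem hW0 (by rw [hW, hrank]; exact hk) (by rw [hW, hrank]; exact hK)
  exact fun A hA => by simpa using hmem 1 h1 A hA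

variable {n : ℕ}

theorem Matrix.trace_eq_zero_of_forall_mul_idempotent_mem
    {M : Submodule K (Matrix (Fin n) (Fin n) K)} (hM : M ≠ ⊤)
    (hl : ∀ e ∈ M, IsIdempotentElem e → ∀ b, b * e ∈ M)
    (hk : Module.finrank K (Matrix (Fin n) (Fin n) K) - Module.finrank K M < n)
    (hK : ((Module.finrank K (Matrix (Fin n) (Fin n) K) - Module.finrank K M : ℕ) : ℕ∞) <
      ENat.card K) :
    ∀ A ∈ M, A.trace = 0 := by
  let φ : Matrix (Fin n) (Fin n) K ≃ₐ[K] Module.End K (Fin n → K) := Matrix.toLinAlgEquiv'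
  let M' : Submodule K (Module.End K (Fin n → K)) := M.map φ.toLinearEquiv.toLinearMap
  have hmem : ∀ A, φ A ∈ M' ↔ A ∈ M := fun A =>
    (Submodule.mem_map_equiv M (e := φ.toLinearEquiv)).trans (by simp)
  have h1 : Module.finrank K (Module.End K (Fin n → K)) =
      Module.finrank K (Matrix (Fin n) (Fin n) K) := φ.toLinearEquiv.finrank_eq.symm
  have h2 : Module.finrank K M' = Module.finrank K M :=
    LinearEquiv.finrank_map_eq φ.toLinearEquiv M
  have h3 := _root_.trace_eq_zero_of_forall_mul_idempotent_mem (M := M') (by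
      intro h
      refine hM (eq_top_iff.2 fun A _ => (hmem A).1 (by rw [h]; trivial))) (by
      intro e he hid b
      obtain ⟨e, rfl⟩ := φ.surjective e
      obtain ⟨b, rfl⟩ := φ.surjective b
      rw [← map_mul, hmem]
      refine hl e ((hmem e).1 he) (φ.injective ?_) b
      rw [map_mul]; exact hid)
    (by rwa [h1, h2, Module.finrank_fin_fun]) (by rwa [h1, h2])
  intro A hA
  have h4 := h3 (φ A) ((hmem A).2 hA)
  exact (Matrix.trace_toLin'_eq A).symm.trans h4

theorem Matrix.trace_eq_zero_of_forall_idempotent_mul_mem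
    {M : Submodule K (Matrix (Fin n) (Fin n) K)} (hM : M ≠ ⊤)
    (hr : ∀ e ∈ M, IsIdempotentElem e → ∀ c, e * c ∈ M)
    (hk : Module.finrank K (Matrix (Fin n) (Fin n) K) - Module.finrank K M < n)
    (hK : ((Module.finrank K (Matrix (Fin n) (Fin n) K) - Module.finrank K M : ℕ) : ℕ∞) <
      ENat.card K) :
    ∀ A ∈ M, A.trace = 0 := by
  let τ := Matrix.transposeLinearEquiv (Fin n) (Fin n) K K
  let M' : Submodule K (Matrix (Fin n) (Fin n) K) := M.map τ.toLinearMap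
  have hmem : ∀ A : Matrix (Fin n) (Fin n) K, A ∈ M' ↔ A.transpose ∈ M := fun A =>
    Submodule.mem_map_equiv M (e := τ)
  have h2 : Module.finrank K M' = Module.finrank K M := LinearEquiv.finrank_map_eq τ M
  have h3 := Matrix.trace_eq_zero_of_forall_mul_idempotent_mem (M := M') (by
      intro h
      refine hM (eq_top_iff.2 fun A _ => ?_)
      rw [← Matrix.transpose_transpose A, ← hmem, h]; trivial) (by
      intro e he hid b
      rw [hmem, Matrix.transpose_mul]
      refine hr _ ((hmem e).1 he) ?_ _
      change e.transpose * e.transpose = _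
      rw [← Matrix.transpose_mul, hid.eq])
    (by rwa [h2]) (by rwa [h2])
  intro A hA
  rw [← Matrix.trace_transpose]
  exact h3 _ ((hmem _).2 (by rwa [Matrix.transpose_transpose]))

end Trace

/-! ### Idempotents and the radical -/

section Radical

theorem IsMathieuSubspace.mul_mem_or_mul_mem {R A : Type*} [CommRing R] [Ring A] [Algebra R A]
    {θ : MathieuType} {M : Submodule R A} (hM : IsMathieuSubspace θ M) :
    (∀ e ∈ M, IsIdempotentElem e → ∀ b, b * e ∈ M) ∨
      (∀ e ∈ M, IsIdempotentElem e → ∀ c, e * c ∈ M) := by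
  have hpow : ∀ e : A, IsIdempotentElem e → ∀ m, 1 ≤ m → e ^ m = e := fun e he m hm => by
    obtain ⟨k, rfl⟩ := Nat.exists_eq_succ_of_ne_zero (Nat.one_le_iff_ne_zero.1 hm)
    exact he.pow_succ_eq k
  have key : ∀ e ∈ M, IsIdempotentElem e → ∀ m, 1 ≤ m → e ^ m ∈ M := fun e he hid m hm => by
    rwa [hpow e hid m hm]
  cases θ with
  | left =>
    refine .inl fun e he hid b => ?_
    obtain ⟨m, hm, h1⟩ := ((hM e b 1 (key e he hid)).and (eventually_ge_atTop 1)).exists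
    rwa [hpow e hid m h1] at hm
  | right =>
    refine .inr fun e he hid c => ?_
    obtain ⟨m, hm, h1⟩ := ((hM e 1 c (key e he hid)).and (eventually_ge_atTop 1)).exists
    rwa [hpow e hid m h1] at hm
  | preTwoSided =>
    refine .inl fun e he hid b => ?_
    obtain ⟨m, hm, h1⟩ := ((hM e b 1 (key e he hid)).and (eventually_ge_atTop 1)).exists
    rw [hpow e hid m h1] at hm
    exact hm.1
  | twoSided =>
    refine .inl fun e he hid b => ?_
    obtain ⟨m, hm, h1⟩ := ((hM e b 1 (key e he hid)).and (eventually_ge_atTop 1)).exists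
    rwa [hpow e hid m h1, mul_one] at hm

theorem exists_idempotent_mem_of_not_isNilpotent {K A : Type*} [Field K] [Ring A] [Algebra K A]
    [FiniteDimensional K A] {M : Submodule K A} {a : A} (ha : a ∈ mathieuRadical (M : Set A))
    (hnil : ¬ IsNilpotent a) : ∃ e ∈ M, IsIdempotentElem e ∧ e ≠ 0 := by
  open Polynomial in
  obtain ⟨N₀, hN₀⟩ := eventually_atTop.1 ha
  obtain ⟨g, hg, hXg⟩ := Polynomial.exists_eq_pow_rootMultiplicity_mul_and_not_dvd (minpoly K a)
    (minpoly.ne_zero (Algebra.IsIntegral.isIntegral a)) 0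
  rw [map_zero, sub_zero] at hg hXg
  generalize (minpoly K a).rootMultiplicity 0 = s at hg
  set N := max N₀ s with hN
  -- The idempotent is the value at `a` of `u * X ^ N`, the projection onto the part where `a` is
  -- invertible; `N ≥ N₀` puts it in `M`, and `N ≥ s` makes `X ^ N * g` vanish at `a`.
  obtain ⟨u, v, huv⟩ : IsCoprime ((X : K[X]) ^ N) g :=
    IsCoprime.pow_left ((Polynomial.irreducible_X.coprime_iff_not_dvd).2 hXg)
  have hzero : aeval a ((X : K[X]) ^ N * g) = 0 := by
    have h1 : (X : K[X]) ^ N * g = X ^ (N - s) * minpoly K a := by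
      rw [hg, ← mul_assoc, ← pow_add, Nat.sub_add_cancel (le_max_right N₀ s)]
    rw [h1, map_mul, minpoly.aeval, mul_zero]
  have hmem : ∀ q : K[X], aeval a (q * X ^ N) ∈ M := by
    intro q
    induction q using Polynomial.induction_on' with
    | add p q hp hq => rw [add_mul, map_add]; exact M.add_mem hp hq
    | monomial k c =>
      rw [map_mul, aeval_monomial, map_pow, aeval_X, mul_assoc, ← pow_add, ← Algebra.smul_def]
      exact M.smul_mem c (hN₀ _ (by omega))
  refine ⟨aeval a (u * X ^ N), hmem u, ?_, fun h0 => hnil ⟨N, ?_⟩⟩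
  · have h1 : u * X ^ N * (u * X ^ N) = u * X ^ N - u * v * (X ^ N * g) := by
      linear_combination (u * X ^ N) * huv
    change _ * _ = _
    rw [← map_mul, h1, map_sub, map_mul (aeval a) (u * v), hzero, mul_zero, sub_zero]
  · have h1 : (X : K[X]) ^ N = X ^ N * (u * X ^ N) + v * (X ^ N * g) := by
      linear_combination -(X ^ N) * huv
    have h2 := congrArg (aeval a) h1
    rw [map_add, map_mul _ _ (u * X ^ N), h0, map_mul _ v, hzero, mul_zero, mul_zero, add_zero,
      map_pow, aeval_X] at h2
    exact h2

/-- The trace of an idempotent is its rank in `K`, so the characteristic divides a rank between `1`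
and `n`; only rank `n` is possible. -/
theorem Matrix.eq_one_of_trace_eq_zero_of_isIdempotentElem {K : Type*} [Field K] {n : ℕ}
    (hchar : ringChar K ∉ Finset.Icc 1 (n - 1)) {e : Matrix (Fin n) (Fin n) K}
    (he : IsIdempotentElem e) (he0 : e ≠ 0) (htr : e.trace = 0) : e = 1 := by
  let φ : Matrix (Fin n) (Fin n) K ≃ₐ[K] Module.End K (Fin n → K) := Matrix.toLinAlgEquiv'
  have hid : IsIdempotentElem (φ e) := by
    change φ e * φ e = φ e
    rw [← map_mul, he.eq]
  have h1 := (LinearMap.IsIdempotentElem.isProj_range _ hid).trace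
  have h2 : LinearMap.trace K _ (φ e) = 0 := (Matrix.trace_toLin'_eq e).trans htr
  rw [h2, eq_comm, ringChar.spec] at h1
  have h3 : 1 ≤ Module.finrank K (LinearMap.range (φ e)) := by
    refine Submodule.one_le_finrank_iff.2 fun h => he0 (φ.injective ?_)
    rw [map_zero]
    exact LinearMap.range_eq_bot.1 h
  have h4 : Module.finrank K (LinearMap.range (φ e)) ≤ n := by
    simpa using Submodule.finrank_le (LinearMap.range (φ e))
  have h5 := Nat.le_of_dvd h3 h1
  have h6 : ringChar K ≠ 0 := fun h => by
    rw [h, zero_dvd_iff] at h1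
    omega
  rw [Finset.mem_Icc] at hchar
  have h7 : LinearMap.range (φ e) = ⊤ := Submodule.eq_top_of_finrank_eq (by
    rw [Module.finrank_fin_fun]; omega)
  refine φ.injective (LinearMap.ext fun v => ?_)
  rw [map_one]
  exact (LinearMap.IsIdempotentElem.isProj_range _ hid).map_id v (by rw [h7]; trivial)

end Radical

theorem mainTheorem1 {K : Type*} [Field K] (n : ℕ)
    (M : Submodule K (Matrix (Fin n) (Fin n) K))
    (hproper : M ≠ ⊤)
    (hM : ∃ θ : MathieuType, IsMathieuSubspace θ M)
    (hcodim : (Module.finrank K (Matrix (Fin n) (Fin n) K ⧸ M) : ℕ∞) <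
      min (n : ℕ∞) (ENat.card K)) :
    (∀ A ∈ M, Matrix.trace A = 0) ∧
      (ringChar K ∉ Finset.Icc 1 (n - 1) →
        (∀ A ∈ mathieuRadical (M : Set (Matrix (Fin n) (Fin n) K)), IsNilpotent A) ∧
          IsMathieuSubspace MathieuType.twoSided M) := by
  obtain ⟨θ, hθ⟩ := hM
  rw [lt_min_iff, Nat.cast_lt,
    (Nat.sub_eq_of_eq_add (Submodule.finrank_quotient_add_finrank M).symm).symm] at hcodim
  have htr : ∀ A ∈ M, Matrix.trace A = 0 := hθ.mul_mem_or_mul_mem.elim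
    (fun h => Matrix.trace_eq_zero_of_forall_mul_idempotent_mem hproper h hcodim.1 hcodim.2)
    (fun h => Matrix.trace_eq_zero_of_forall_idempotent_mul_mem hproper h hcodim.1 hcodim.2)
  refine ⟨htr, fun hchar => ?_⟩
  have hone : (1 : Matrix (Fin n) (Fin n) K) ∉ M := fun h1 =>
    hproper <| eq_top_iff.2 fun A _ => hθ.mul_mem_or_mul_mem.elim
      (fun h => by simpa using h 1 h1 IsIdempotentElem.one A)
      (fun h => by simpa using h 1 h1 IsIdempotentElem.one A)
  have hrad : ∀ A ∈ mathieuRadical (M : Set (Matrix (Fin n) (Fin n) K)), IsNilpotent A := by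
    intro A hA
    by_contra hnil
    obtain ⟨e, heM, he, he0⟩ := exists_idempotent_mem_of_not_isNilpotent hA hnil
    exact hone (Matrix.eq_one_of_trace_eq_zero_of_isIdempotentElem hchar he he0 (htr e heM) ▸ heM)
  refine ⟨hrad, fun a b c ha => ?_⟩
  obtain ⟨N, hN⟩ := hrad a (eventually_atTop.2 ⟨1, ha⟩)
  refine eventually_atTop.2 ⟨N, fun m hm => ?_⟩
  rw [pow_eq_zero_of_le hm hN, mul_zero, zero_mul]
  exact M.zero_mem
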